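/- Conventions. A measure-theoretic dynamical system is an automorphism (an invertible measure-preserving transformation) of a standard Borel probability space. A class $\mathscr{F}$ of such systems is called \emph{characteristic} if it is closed under taking isomorphisms, factors and countable joinings. An \emph{$\mathscr{F}$-factor} of a system $(Z,\mathcal{D},\kappa,R)$ is a factor sub-$\sigma$-algebra of $\mathcal{D}$ on which the action of $R$ yields a system in $\mathscr{F}$; every system has (for non-empty $\mathscr{F}$) a largest $\mathscr{F}$-factor with respect to inclusion, denoted by $\mathcal{D}_{\mathscr{F}}$. A topological dynamical system $(X,T)$ consists of a homeomorphism $T$ of a compact metric space $X$. For $x\in X$, $V_T(x)$ is the set of all Borel probability measures on $X$ which are weak-$*$ limits of $\frac1{N_\ell}\sum_{1\le n\leq N_\ell}\delta_{T^nx}$ for some increasing sequence $(N_\ell)$, and $V(X,T)=\bigcup_{x\in X}V_T(x)$ is the set of \emph{visible} measures (all of which are $T$-invariant). $\mathscr{C}_{\mathscr{F}}$ denotes the class of topological dynamical systems $(X,T)$ such that $(X,\mathcal{B}(X),\nu,T)\in\mathscr{F}$ for each $\nu\in V(X,T)$. Let $\boldsymbol{u}\colon\mathbb{N}\to\mathbb{C}$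 be bounded. Extend it to $\mathbb{Z}$ by $\boldsymbol{u}(-n)=\boldsymbol{u}(n)$ for $n\geq 1$, with $\boldsymbol{u}(0)\in\mathbb{C}$ arbitrary, let $S$ be the left shift on $\mathbb{C}^{\mathbb{Z}}$, and let $X_{\boldsymbol{u}}=\overline{\{S^k\boldsymbol{u}:k\in\mathbb{Z}\}}$ (closure in the product topology; a compact set) and $\pi_0\colon X_{\boldsymbol{u}}\to\mathbb{C}$, $\pi_0(z)=z_0$. One says that $\boldsymbol{u}$ satisfies the \emph{Veech condition} with respect to $\mathscr{F}$ if, for each $\kappa\in V_S(\boldsymbol{u})$, the function $\pi_0$ is orthogonal in $L^2(X_{\boldsymbol{u}},\kappa)$ to $L^2((\mathcal{B}(X_{\boldsymbol{u}}),\kappa)_{\mathscr{F}})$, the space of square-integrable functions measurable with respect to the largest $\mathscr{F}$-factor of $(X_{\boldsymbol{u}},\mathcal{B}(X_{\boldsymbol{u}}),\kappa,S)$. Theorem. Let $\mathscr{F}$ be a characteristic class and let $\boldsymbol{u}\colon\mathbb{N}\to\mathbb{C}$ be a bounded arithmetic function. If $\boldsymbol{u}$ satisfies the Veech condition with respect to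 $\mathscr{F}$, then $\boldsymbol{u}\perp\mathscr{C}_{\mathscr{F}}$, that is, for every $(X,T)\in\mathscr{C}_{\mathscr{F}}$, every complex-valued $f\in C(X)$ and every $x\in X$, $$\lim_{N\to\infty}\frac1N\sum_{1\le n\leq N}f(T^nx)\boldsymbol{u}(n)=0.$$ -/

import Mathlib

open Filter Topology MeasureTheory TopologicalSpace

/-! ### Measure-theoretic dynamical systems -/

/-- A measure-theoretic dynamical system: an automorphism `T` (an invertible, bi-measurable,
measure-preserving map) of a standard Borel probability space. -/
structure MPSystem where
  carrier : Type
  [measurableSpace : MeasurableSpace carrier]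
  [standardBorel : StandardBorelSpace carrier]
  measure : Measure carrier
  [isProbability : IsProbabilityMeasure measure]
  map : carrier ≃ᵐ carrier
  measurePreserving : MeasurePreserving map measure measure

namespace MPSystem

attribute [instance] MPSystem.measurableSpace MPSystem.standardBorel MPSystem.isProbability

/-- `π` is a factor map from `S` to `S'`: it is measurable, sends the measure of `S` to the
measure of `S'`, and is equivariant almost everywhere. -/
def IsFactorMap (S S' : MPSystem) (π : S.carrier → S'.carrier) : Prop :=
  MeasurePreserving π S.measure S'.measure ∧ ∀ᵐ z ∂S.measure, π (S.map z) = S'.map (π z)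

/-- Two systems are isomorphic: there are factor maps in both directions which are inverse to
each other almost everywhere. -/
def Isomorphic (S S' : MPSystem) : Prop :=
  ∃ (π : S.carrier → S'.carrier) (ψ : S'.carrier → S.carrier),
    IsFactorMap S S' π ∧ IsFactorMap S' S ψ ∧
      (∀ᵐ z ∂S.measure, ψ (π z) = z) ∧ ∀ᵐ y ∂S'.measure, π (ψ y) = y

/-- The product automorphism of a family of systems. -/
def prodMap {ι : Type} (S : ι → MPSystem) : (∀ i, (S i).carrier) ≃ᵐ (∀ i, (S i).carrier) :=
  MeasurableEquiv.piCongrRight fun i => (S i).map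

/-- `ρ` is a joining of the systems `S i`: a probability measure on the product space, invariant
under the product automorphism, whose marginals are the measures of the `S i`. -/
structure IsJoining {ι : Type} (S : ι → MPSystem) (ρ : Measure (∀ i, (S i).carrier)) : Prop where
  isProbability : IsProbabilityMeasure ρ
  invariant : MeasurePreserving (prodMap S) ρ ρ
  marginal : ∀ i, ρ.map (fun x => x i) = (S i).measure

/-- A joining of countably many systems, regarded as a system. -/
def joiningSystem {ι : Type} [Countable ι] (S : ι → MPSystem)
    (ρ : Measure (∀ i, (S i).carrier)) (hρ : IsJoining S ρ) : MPSystem :=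
  haveI := hρ.isProbability
  { carrier := ∀ i, (S i).carrier
    measure := ρ
    map := prodMap S
    measurePreserving := hρ.invariant }

/-- A class of systems is characteristic if it is closed under isomorphisms, factors and
(finite or countably infinite) joinings. -/
structure IsCharacteristic (F : MPSystem → Prop) : Prop where
  isomorphic : ∀ S S' : MPSystem, F S → Isomorphic S S' → F S'
  factor : ∀ (S S' : MPSystem) (π : S.carrier → S'.carrier), F S → IsFactorMap S S' π → F S'
  joining : ∀ (ι : Type) [Countable ι] [Nonempty ι] (S : ι → MPSystem)
    (ρ : Measure (∀ i, (S i).carrier)) (hρ : IsJoining S ρ),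
    (∀ i, F (S i)) → F (joiningSystem S ρ hρ)

/-- `A` is an `F`-factor of `S`: it is a sub-σ-algebra which, modulo null sets, is the σ-algebra
generated by a factor map `π` onto a system `S'` belonging to `F`. Thus `S'` is a standard Borel
model of the action of `S` on `A`. -/
def IsFFactor (F : MPSystem → Prop) (S : MPSystem) (A : MeasurableSpace S.carrier) : Prop :=
  A ≤ S.measurableSpace ∧
    ∃ (S' : MPSystem) (π : S.carrier → S'.carrier), F S' ∧ IsFactorMap S S' π ∧
      eventuallyMeasurableSpace A (ae S.measure) =
        eventuallyMeasurableSpace (S'.measurableSpace.comap π) (ae S.measure)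

/-- The largest `F`-factor of `S`, obtained as the supremum of all `F`-factors. It is shown below
(`isGreatest_largestFactor`) to be itself an `F`-factor, hence the largest one with respect to
inclusion, whenever `F` is characteristic and non-empty. -/
@[reducible] def largestFactor (F : MPSystem → Prop) (S : MPSystem) : MeasurableSpace S.carrier :=
  sSup {A | IsFFactor F S A}

theorem eventuallyMeasurableSpace_le_of_le {α : Type*} {l : Filter α} [CountableInterFilter l]
    {A B : MeasurableSpace α} (h : A ≤ eventuallyMeasurableSpace B l) :
    eventuallyMeasurableSpace A l ≤ eventuallyMeasurableSpace B l := by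
  rintro s ⟨t, ht, hst⟩
  obtain ⟨r, hr, htr⟩ := h t ht
  exact ⟨r, hr, hst.trans htr⟩

/-- A family of sub-σ-algebras of a standard Borel probability space has a countable subfamily
which generates all of its members modulo null sets. -/
theorem exists_countable_subfamily {Z : Type} [mZ : MeasurableSpace Z] [StandardBorelSpace Z]
    (κ : Measure Z) [IsProbabilityMeasure κ] (G : Set (MeasurableSpace Z))
    (hne : G.Nonempty) (hG : ∀ A ∈ G, A ≤ mZ) :
    ∃ A : ℕ → MeasurableSpace Z, (∀ i, A i ∈ G) ∧
      ∀ B ∈ G, B ≤ eventuallyMeasurableSpace (⨆ i, A i) (ae κ) := by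
  classical
  let V : Set (Lp ℝ 1 κ) := {f | ∃ A ∈ G, AEStronglyMeasurable[A] f κ}
  have : Fact ((1 : ENNReal) ≠ ⊤) := ⟨ENNReal.one_ne_top⟩
  obtain ⟨c, hcV, hc, hVc⟩ := (IsSeparable.of_separableSpace V).exists_countable_dense_subset
  have h1 : ∀ f : c, ∃ A ∈ G, AEStronglyMeasurable[A] (f : Lp ℝ 1 κ) κ := fun f => hcV f.2
  choose A0 hA0 hm0 using h1
  obtain ⟨A1, hA1⟩ := hne
  have := hc.to_subtype
  let g : ℕ → MeasurableSpace Z := fun n =>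
    match @Encodable.decode c (Encodable.ofCountable c) n with
    | some f => A0 f
    | none => A1
  have hg : ∀ n, g n ∈ G := by
    intro n
    simp only [g]
    split
    · exact hA0 _
    · exact hA1
  have hgle : (⨆ i, g i) ≤ mZ := iSup_le fun i => hG _ (hg i)
  have hcg : c ⊆ {f : Lp ℝ 1 κ | AEStronglyMeasurable[⨆ i, g i] f κ} := by
    intro f hf
    have h2 : A0 ⟨f, hf⟩ ≤ ⨆ i, g i := by
      refine le_trans (le_of_eq ?_)
        (le_iSup g (@Encodable.encode c (Encodable.ofCountable c) ⟨f, hf⟩))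
      simp only [g]
      rw [@Encodable.encodek c (Encodable.ofCountable c)]
    exact (hm0 ⟨f, hf⟩).mono h2
  have hV : V ⊆ {f : Lp ℝ 1 κ | AEStronglyMeasurable[⨆ i, g i] f κ} :=
    hVc.trans (closure_minimal hcg (isClosed_aestronglyMeasurable hgle))
  refine ⟨g, hg, fun B hB s hs => ?_⟩
  have hs' : MeasurableSet[mZ] s := hG B hB s hs
  have hmem : indicatorConstLp 1 hs' (measure_ne_top κ s) (1 : ℝ) ∈ V := by
    refine ⟨B, hB, s.indicator fun _ => 1, ?_, indicatorConstLp_coeFn⟩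
    exact (@stronglyMeasurable_const Z ℝ B _ 1).indicator hs
  obtain ⟨h, hh, hsh⟩ := hV hmem
  refine ⟨h ⁻¹' {1}, hh.measurable (measurableSet_singleton 1), ?_⟩
  filter_upwards [hsh, indicatorConstLp_coeFn (p := 1) (hs := hs')
    (hμs := measure_ne_top κ s) (c := (1 : ℝ))] with z hz1 hz2
  rw [hz2] at hz1
  apply propext
  change z ∈ s ↔ h z = 1
  rw [← hz1]
  by_cases hzs : z ∈ s <;> simp [hzs]

/-- A system has a largest `F`-factor (in the sense of inclusion). -/
theorem isGreatest_largestFactor {F : MPSystem → Prop} (hF : IsCharacteristic F)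
    (hne : ∃ S, F S) (S : MPSystem) :
    IsGreatest {A | IsFFactor F S A} (largestFactor F S) := by
  refine ⟨?_, fun A hA => le_sSup hA⟩
  have hle : largestFactor F S ≤ S.measurableSpace := sSup_le fun A hA => hA.1
  have hG : ({A | IsFFactor F S A} : Set (MeasurableSpace S.carrier)).Nonempty := by
    obtain ⟨S0, hS0⟩ := hne
    let P : MPSystem :=
      { carrier := Unit
        measure := Measure.dirac ()
        map := MeasurableEquiv.refl Unit
        measurePreserving := MeasurePreserving.id _ }
    have hfac : ∀ S1 : MPSystem, IsFactorMap S1 P fun _ => () := fun S1 =>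
      ⟨⟨measurable_const, by simp [P, Measure.map_const]⟩, Eventually.of_forall fun _ => rfl⟩
    refine ⟨P.measurableSpace.comap fun _ => (), ?_, P, _, hF.factor S0 P _ hS0 (hfac S0),
      hfac S, rfl⟩
    exact (hfac S).1.measurable.comap_le
  obtain ⟨A, hA, hAB⟩ := exists_countable_subfamily S.measure _ hG fun A hA => hA.1
  choose Y π hY hπ hev using fun i => (hA i).2
  let Φ : S.carrier → ∀ i, (Y i).carrier := fun z i => π i z
  have hΦ : Measurable Φ := measurable_pi_lambda _ fun i => (hπ i).1.measurable
  have hequi : ∀ᵐ z ∂S.measure, Φ (S.map z) = prodMap Y (Φ z) := by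
    filter_upwards [ae_all_iff.2 fun i => (hπ i).2] with z hz
    funext i
    exact hz i
  have hJ : IsJoining Y (S.measure.map Φ) := by
    refine ⟨Measure.isProbabilityMeasure_map hΦ.aemeasurable, ⟨(prodMap Y).measurable, ?_⟩, ?_⟩
    · rw [Measure.map_map (prodMap Y).measurable hΦ]
      have : (prodMap Y ∘ Φ) =ᵐ[S.measure] (Φ ∘ S.map) := by
        filter_upwards [hequi] with z hz
        exact hz.symm
      rw [Measure.map_congr this, ← Measure.map_map hΦ S.map.measurable,
        S.measurePreserving.map_eq]
    · intro i
      rw [Measure.map_map (measurable_pi_apply i) hΦ]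
      exact (hπ i).1.map_eq
  have hcomap : ∀ i, (Y i).measurableSpace.comap (π i) ≤
      (joiningSystem Y _ hJ).measurableSpace.comap Φ := by
    rintro i _ ⟨t, ht, rfl⟩
    exact ⟨(fun y => y i) ⁻¹' t, measurable_pi_apply i ht, rfl⟩
  refine ⟨hle, joiningSystem Y _ hJ, Φ, hF.joining ℕ Y _ hJ hY, ⟨⟨hΦ, rfl⟩, hequi⟩, ?_⟩
  apply le_antisymm
  · apply eventuallyMeasurableSpace_le_of_le
    refine sSup_le fun B hB => (hAB B hB).trans ?_
    apply eventuallyMeasurableSpace_le_of_le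
    refine iSup_le fun i => le_eventuallyMeasurableSpace.trans ((hev i).le.trans ?_)
    exact eventuallyMeasurableSpace_le_of_le ((hcomap i).trans le_eventuallyMeasurableSpace)
  · apply eventuallyMeasurableSpace_le_of_le
    have hpi : (joiningSystem Y _ hJ).measurableSpace.comap Φ =
        ⨆ i, (Y i).measurableSpace.comap (π i) := by
      change MeasurableSpace.comap Φ (⨆ i, (Y i).measurableSpace.comap fun y => y i) = _
      rw [MeasurableSpace.comap_iSup]
      simp only [MeasurableSpace.comap_comp]
      rfl
    refine hpi.le.trans (iSup_le fun i => le_eventuallyMeasurableSpace.trans ((hev i).ge.trans ?_))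
    exact eventuallyMeasurableSpace_le_of_le
      ((le_sSup (hA i)).trans le_eventuallyMeasurableSpace)

end MPSystem

/-! ### Topological dynamical systems and visible measures -/

/-- The system `(X, 𝓑(X), ν, T)` given by a `T`-invariant Borel probability measure `ν`. -/
def measureSystem {X : Type} [TopologicalSpace X] [MeasurableSpace X] [BorelSpace X]
    [StandardBorelSpace X] (T : X ≃ₜ X) (ν : Measure X) [IsProbabilityMeasure ν]
    (hν : MeasurePreserving T ν ν) : MPSystem where
  carrier := X
  measure := ν
  map := T.toMeasurableEquiv
  measurePreserving := hν

/-- `x` is generic for `ν` along `N`: the measures `(1 / N ℓ) ∑_{1 ≤ n ≤ N ℓ} δ_{T^n x}` converge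
to `ν` in the weak-* topology. -/
def IsGenericAlong {X : Type} [TopologicalSpace X] [MeasurableSpace X] (T : X ≃ₜ X) (x : X)
    (ν : Measure X) (N : ℕ → ℕ) : Prop :=
  ∀ f : C(X, ℂ), Tendsto (fun ℓ => (1 / (N ℓ : ℂ)) * ∑ n ∈ Finset.Icc 1 (N ℓ), f (T^[n] x)) atTop
    (𝓝 (∫ y, f y ∂ν))

/-- `V_T(x)`: the probability measures for which `x` is generic along some increasing sequence. -/
def visibleFrom {X : Type} [TopologicalSpace X] [MeasurableSpace X] (T : X ≃ₜ X) (x : X) :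
    Set (Measure X) :=
  {ν | IsProbabilityMeasure ν ∧ ∃ N : ℕ → ℕ, StrictMono N ∧ IsGenericAlong T x ν N}

/-- `V(X, T)`: the visible measures. -/
def visibleMeasures {X : Type} [TopologicalSpace X] [MeasurableSpace X] (T : X ≃ₜ X) :
    Set (Measure X) :=
  ⋃ x, visibleFrom T x

/-- `(X, T)` belongs to the topological class determined by `F`: every visible measure, which is
necessarily invariant, gives a system in `F`. -/
def MemTopClass (F : MPSystem → Prop) {X : Type} [TopologicalSpace X] [MeasurableSpace X]
    [BorelSpace X] [StandardBorelSpace X] (T : X ≃ₜ X) : Prop :=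
  ∀ (ν : Measure X) [IsProbabilityMeasure ν] (hν : MeasurePreserving T ν ν),
    ν ∈ visibleMeasures T → F (measureSystem T ν hν)

/-- `u ⟂ (X, T)`, the Sarnak property of `(X, T)` with respect to `u`. -/
def SarnakProperty (u : ℕ → ℂ) {X : Type} [TopologicalSpace X] (T : X ≃ₜ X) : Prop :=
  ∀ (f : C(X, ℂ)) (x : X),
    Tendsto (fun N : ℕ => (1 / (N : ℂ)) * ∑ n ∈ Finset.Icc 1 N, f (T^[n] x) * u n) atTop (𝓝 0)

/-! ### Furstenberg systems of an arithmetic function -/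

/-- The left shift on complex two-sided sequences. -/
noncomputable def leftShift : (ℤ → ℂ) ≃ₜ (ℤ → ℂ) where
  toFun v k := v (k + 1)
  invFun v k := v (k - 1)
  left_inv v := by funext k; simp
  right_inv v := by funext k; simp
  continuous_toFun := by fun_prop
  continuous_invFun := by fun_prop

/-- The symmetric extension of `u` to `ℤ`. -/
noncomputable def symmExt (u : ℕ → ℂ) : ℤ → ℂ := fun k => u k.natAbs

/-- The space `X_u`: the closure of the two-sided orbit `{S^k u : k ∈ ℤ}`, where
`(S^k u) n = u (n + k)`. For bounded `u` it is compact. -/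
def orbitClosure (u : ℕ → ℂ) : Set (ℤ → ℂ) :=
  closure (Set.range fun k : ℤ => fun n : ℤ => symmExt u (n + k))

theorem leftShift_mem_orbitClosure_iff (u : ℕ → ℂ) (v : ℤ → ℂ) :
    v ∈ orbitClosure u ↔ leftShift v ∈ orbitClosure u := by
  have h : leftShift ⁻¹' (Set.range fun k : ℤ => fun n : ℤ => symmExt u (n + k)) =
      Set.range fun k : ℤ => fun n : ℤ => symmExt u (n + k) := by
    ext w
    constructor
    · rintro ⟨k, hk⟩
      refine ⟨k - 1, ?_⟩
      apply leftShift.injective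
      rw [← hk]
      funext n
      change symmExt u (n + 1 + (k - 1)) = symmExt u (n + k)
      congr 1
      ring
    · rintro ⟨k, rfl⟩
      refine ⟨k + 1, ?_⟩
      funext n
      change symmExt u (n + (k + 1)) = symmExt u (n + 1 + k)
      congr 1
      ring
  change _ ↔ v ∈ leftShift ⁻¹' orbitClosure u
  rw [orbitClosure, leftShift.preimage_closure, h]

/-- The shift `S` on `X_u`. -/
noncomputable def orbitShift (u : ℕ → ℂ) : orbitClosure u ≃ₜ orbitClosure u :=
  leftShift.subtype (leftShift_mem_orbitClosure_iff u)

instance instStandardBorelSpaceOrbitClosure (u : ℕ → ℂ) : StandardBorelSpace (orbitClosure u) :=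
  isClosed_closure.measurableSet.standardBorel

/-- `u` (extended to `ℤ`) as a point of `X_u`. -/
noncomputable def orbitPoint (u : ℕ → ℂ) : orbitClosure u :=
  ⟨symmExt u, subset_closure ⟨0, by simp⟩⟩

/-- The coordinate function `π₀ : X_u → ℂ`, `z ↦ z₀`. -/
def coordZero (u : ℕ → ℂ) : orbitClosure u → ℂ := fun z => z.1 0

/-- The function `g` is orthogonal to `L²(A)`, the space of square-integrable `A`-measurable
functions. -/
def OrthogonalToL2 {Z : Type} [MeasurableSpace Z] (κ : Measure Z) (A : MeasurableSpace Z)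
    (g : Z → ℂ) : Prop :=
  ∀ h : Z → ℂ, StronglyMeasurable[A] h → MemLp h 2 κ →
    ∫ z, g z * (starRingEnd ℂ) (h z) ∂κ = 0

/-- The Veech condition for `u` with respect to `F`: for each Furstenberg system `κ ∈ V_S(u)`, the
function `π₀` is orthogonal to the `L²`-space of the largest `F`-factor of `(X_u, κ, S)`. -/
def VeechCondition (F : MPSystem → Prop) (u : ℕ → ℂ) : Prop :=
  ∀ (κ : Measure (orbitClosure u)) [IsProbabilityMeasure κ]
    (hκ : MeasurePreserving (orbitShift u) κ κ), κ ∈ visibleFrom (orbitShift u) (orbitPoint u) →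
    OrthogonalToL2 κ (MPSystem.largestFactor F (measureSystem (orbitShift u) κ hκ)) (coordZero u)

/-! If the averages do not tend to zero, pick a subsequence along which they stay away from zero and
along which the pair (`u`, `x`) is generic for some measure `ρ` on the product of `X_u` and `X`.
This `ρ` is a joining of a Furstenberg system of `u` with a system given by a visible measure of
`T`, hence with a system in `F`. The averages converge along this subsequence to the integral of `π₀
⊗ f` against `ρ`, so it suffices that this integral vanishes.

The integral is that of `π₀ · E`, where `E z` is the conditional expectation of `f` given `z`. By
the Veech condition it vanishes once `E` is measurable with respect to the largest `F`-factor
(`measurable_largestFactor_integral_condKernel`). To see this, choose, given `z`, an independent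
sequence of points of `X` with the conditional law of `ρ` at `z`. By the strong law of large numbers
the averages of `f` along the sequence recover `E z`, so `E` is almost surely a function `G` of the
sequence alone. The law of the sequence is a countable self-joining of a system in `F`, so it lies
in `F`. The itineraries of `E` and `G` have the same law, which makes the process of `E` a factor of
this self-joining. -/

/-! ### Independent powers of a Markov kernel -/

namespace ProbabilityTheory.Kernel

/-- The kernel sending `z` to the law of a sequence of independent variables of law `K z`. -/
noncomputable def iidPower {Z X : Type*} [MeasurableSpace Z] [MeasurableSpace X]
    (K : Kernel Z X) [IsMarkovKernel K] : Kernel Z (ℕ → X) where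
  toFun z := Measure.infinitePi fun _ => K z
  measurable' := by
    refine Measurable.measure_of_isPiSystem_of_isProbabilityMeasure
      generateFrom_squareCylinders.symm
      (isPiSystem_squareCylinders (fun _ => MeasurableSpace.isPiSystem_measurableSet)
        fun _ => MeasurableSet.univ) ?_
    rintro _ ⟨s, t, ht, rfl⟩
    have ht' : ∀ i, MeasurableSet (t i) := fun i => ht i (Set.mem_univ i)
    simp_rw [Measure.infinitePi_pi _ fun i _ => ht' i]
    exact Finset.measurable_prod _ fun i _ => Kernel.measurable_coe K (ht' i)

variable {Z X : Type*} [MeasurableSpace Z] [MeasurableSpace X]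

theorem iidPower_apply (K : Kernel Z X) [IsMarkovKernel K] (z : Z) :
    K.iidPower z = Measure.infinitePi fun _ => K z := rfl

instance (K : Kernel Z X) [IsMarkovKernel K] : IsMarkovKernel K.iidPower :=
  ⟨fun z => by rw [iidPower_apply]; infer_instance⟩

/-- The strong law of large numbers along an independent power of a Markov kernel. -/
theorem ae_iidPower_tendsto (K : Kernel Z X) [IsMarkovKernel K] {f : X → ℂ} (hf : Measurable f)
    {C : ℝ} (hC : ∀ x, ‖f x‖ ≤ C) (z : Z) :
    ∀ᵐ x ∂K.iidPower z, Tendsto (fun n : ℕ => (n : ℝ)⁻¹ • ∑ i ∈ Finset.range n, f (x i)) atTop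
      (𝓝 (∫ y, f y ∂K z)) := by
  rw [iidPower_apply]
  have hmp := measurePreserving_eval_infinitePi fun _ : ℕ => K z
  have hind := iIndepFun_infinitePi (P := fun _ : ℕ => K z) (X := fun _ => f) fun _ => hf
  have h := strong_law_ae (μ := Measure.infinitePi fun _ : ℕ => K z)
    (fun i (x : ℕ → X) => f (x i))
    (Integrable.of_bound (hf.comp (measurable_pi_apply 0)).aestronglyMeasurable C
      (Eventually.of_forall fun x => hC _))
    (fun i j hij => hind.indepFun hij)
    (fun i => ⟨(hf.comp (measurable_pi_apply i)).aemeasurable,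
      (hf.comp (measurable_pi_apply 0)).aemeasurable, (by
        have h1 : ∀ j, Measure.map (fun x : ℕ → X => f (x j)) (Measure.infinitePi fun _ => K z) =
            (K z).map f := fun j => by
          conv_rhs => rw [← (hmp j).map_eq, Measure.map_map hf (hmp j).measurable]
          rfl
        rw [h1, h1])⟩)
  have h0 : ∫ x : ℕ → X, f (x 0) ∂(Measure.infinitePi fun _ : ℕ => K z) = ∫ y, f y ∂K z := by
    conv_rhs => rw [← (hmp 0).map_eq]
    rw [integral_map (hmp 0).measurable.aemeasurable hf.aestronglyMeasurable]
  rwa [h0] at h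

/-- The image of `μ ⊗ₘ K` under a product map over a measure preserving base map. -/
theorem _root_.MeasureTheory.MeasurePreserving.map_compProd {Y : Type*} [MeasurableSpace Y]
    {μ : Measure Z} [SFinite μ] {R : Z → Z} (hR : MeasurePreserving R μ μ) {T : X → Y}
    (hT : Measurable T) (K : Kernel Z X) [IsSFiniteKernel K] (K' : Kernel Z Y) [IsSFiniteKernel K']
    (hK : ∀ᵐ z ∂μ, K' (R z) = (K z).map T) :
    (μ.compProd K).map (Prod.map R T) = μ.compProd K' := by
  have hRT : Measurable (Prod.map R T) := hR.measurable.prodMap hT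
  ext s hs
  rw [Measure.map_apply hRT hs, Measure.compProd_apply (hRT hs), Measure.compProd_apply hs]
  -- Invariance of the base measure moves the right-hand integrand to `R z`, where `hK` compares the
  -- two fibres.
  conv_rhs => rw [← hR.lintegral_comp (Kernel.measurable_kernel_prodMk_left hs)]
  refine lintegral_congr_ae ?_
  filter_upwards [hK] with z hz
  rw [hz, Measure.map_apply hT (measurable_prodMk_left hs)]
  rfl

/-- The disintegration of a measure invariant under a product map is equivariant. -/
theorem ae_condKernel_equivariant [StandardBorelSpace X] [Nonempty X]
    (ρ : Measure (Z × X)) [IsFiniteMeasure ρ] (R : Z ≃ᵐ Z) (T : X ≃ᵐ X)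
    (hR : MeasurePreserving R ρ.fst ρ.fst) (hρ : MeasurePreserving (Prod.map R T) ρ ρ) :
    ∀ᵐ z ∂ρ.fst, ρ.condKernel (R z) = (ρ.condKernel z).map T := by
  -- Equivariance amounts to `K'` being a second disintegration of `ρ`; disintegrations are unique
  -- almost everywhere.
  let K' : Kernel Z X := (ρ.condKernel.comap R R.measurable).map T.symm
  have hsymm : ρ.map (Prod.map R.symm T.symm) = ρ := by
    conv_lhs => rw [← hρ.map_eq]
    rw [Measure.map_map (R.symm.measurable.prodMap T.symm.measurable)
      (R.measurable.prodMap T.measurable)]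
    convert Measure.map_id
    ext z <;> simp
  have h := (hR.symm R).map_compProd T.symm.measurable ρ.condKernel K'
    (Eventually.of_forall fun z => by
      simp only [K']
      rw [Kernel.map_apply _ T.symm.measurable, Kernel.comap_apply, R.apply_symm_apply])
  rw [ρ.disintegrate, hsymm] at h
  filter_upwards [eq_condKernel_of_measure_eq_compProd K' h] with z hz
  rw [← hz]
  simp only [K']
  rw [Kernel.map_apply _ T.symm.measurable, Kernel.comap_apply,
    Measure.map_map T.measurable T.symm.measurable]
  simp

/-- If `K` is equivariant, so is its independent power. -/
theorem iidPower_equivariant (K : Kernel Z X) [IsMarkovKernel K] {z z' : Z} {T : X → X}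
    (hT : Measurable T) (h : K z' = (K z).map T) :
    K.iidPower z' = (K.iidPower z).map fun x i => T (x i) := by
  have : IsProbabilityMeasure ((K z).map T) := h ▸ inferInstance
  rw [iidPower_apply, iidPower_apply, Measure.infinitePi_map_pi _ fun _ => hT]
  simp_rw [h]

end ProbabilityTheory.Kernel

/-! ### Itineraries and joinings with systems of a characteristic class -/

namespace MPSystem

/-- The two-sided itinerary of `z` under `e`, read off by `E`. -/
def itinerary {Z : Type*} [MeasurableSpace Z] (e : Z ≃ᵐ Z) (E : Z → ℂ) (z : Z) : ℤ → ℂ :=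
  fun n => E ((e.toEquiv ^ n : Equiv.Perm Z) z)

section Itinerary

variable {Z Z' : Type*} [MeasurableSpace Z] [MeasurableSpace Z']

theorem itinerary_map (e : Z ≃ᵐ Z) (E : Z → ℂ) (z : Z) :
    itinerary e E (e z) = leftShift (itinerary e E z) := by
  funext n
  change E ((e.toEquiv ^ n) (e.toEquiv z)) = E ((e.toEquiv ^ (n + 1)) z)
  rw [zpow_add_one, Equiv.Perm.mul_apply]

theorem measurePreserving_zpow (e : Z ≃ᵐ Z) {μ : Measure Z} (h : MeasurePreserving e μ μ) (n : ℤ) :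
    MeasurePreserving (e.toEquiv ^ n : Equiv.Perm Z) μ μ := by
  cases n with
  | ofNat n =>
    rw [Int.ofNat_eq_natCast, zpow_natCast, ← Equiv.Perm.iterate_eq_pow]
    exact h.iterate n
  | negSucc n =>
    rw [zpow_negSucc, ← inv_pow, ← Equiv.Perm.iterate_eq_pow]
    exact (h.symm e).iterate (n + 1)

theorem measurable_zpow (e : Z ≃ᵐ Z) (n : ℤ) : Measurable (e.toEquiv ^ n : Equiv.Perm Z) :=
  -- Every measurable map preserves the zero measure, so only measurability is left.
  (measurePreserving_zpow e (μ := 0) ⟨e.measurable, by simp⟩ n).measurable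

theorem measurable_itinerary (e : Z ≃ᵐ Z) {E : Z → ℂ} (hE : Measurable E) :
    Measurable (itinerary e E) :=
  measurable_pi_lambda _ fun n => hE.comp (measurable_zpow e n)

theorem itinerary_semiconj (e : Z ≃ᵐ Z) (e' : Z' ≃ᵐ Z') {π : Z → Z'}
    (h : ∀ z, π (e z) = e' (π z)) (E : Z' → ℂ) (z : Z) :
    itinerary e (E ∘ π) z = itinerary e' E (π z) := by
  have h' : ∀ z, π (e.symm z) = e'.symm (π z) := fun z => by
    rw [← e'.symm_apply_apply (π (e.symm z)), ← h, e.apply_symm_apply]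
  funext n
  change E (π _) = E _
  congr 1
  cases n with
  | ofNat n =>
    simp only [Int.ofNat_eq_natCast, zpow_natCast, ← Equiv.Perm.iterate_eq_pow]
    exact Function.Semiconj.iterate_right h n z
  | negSucc n =>
    simp only [zpow_negSucc, ← inv_pow, ← Equiv.Perm.iterate_eq_pow]
    exact Function.Semiconj.iterate_right h' (n + 1) z

/-- Each power of `e` preserves null sets under preimage, and there are only countably many powers.
-/
theorem itinerary_ae_eq (e : Z ≃ᵐ Z) {μ : Measure Z} (h : MeasurePreserving e μ μ) {E E' : Z → ℂ}
    (hE : E =ᵐ[μ] E') : itinerary e E =ᵐ[μ] itinerary e E' := by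
  filter_upwards [ae_all_iff.2 fun n =>
    (measurePreserving_zpow e h n).quasiMeasurePreserving.ae_eq_comp hE] with z hz
  exact funext hz

end Itinerary

/-- The shift on `ℂ^ℤ` with the law of the itinerary of a measurable function. -/
noncomputable def itinerarySystem (S : MPSystem) (E : S.carrier → ℂ) (hE : Measurable E) :
    MPSystem :=
  have hm := measurable_itinerary S.map hE
  haveI := Measure.isProbabilityMeasure_map (μ := S.measure) hm.aemeasurable
  { carrier := ℤ → ℂ
    measure := S.measure.map (itinerary S.map E)
    map := leftShift.toMeasurableEquiv
    measurePreserving := by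
      refine ⟨leftShift.toMeasurableEquiv.measurable, ?_⟩
      rw [Measure.map_map leftShift.toMeasurableEquiv.measurable hm]
      have : (leftShift.toMeasurableEquiv ∘ itinerary S.map E) = itinerary S.map E ∘ S.map :=
        funext fun z => (itinerary_map S.map E z).symm
      rw [this, ← Measure.map_map hm S.map.measurable, S.measurePreserving.map_eq] }

theorem isFactorMap_itinerary (S : MPSystem) (E : S.carrier → ℂ) (hE : Measurable E) :
    IsFactorMap S (itinerarySystem S E hE) (itinerary S.map E) :=
  ⟨⟨measurable_itinerary S.map hE, rfl⟩, Eventually.of_forall fun z => itinerary_map S.map E z⟩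

/-- If the itinerary of `E` gives a system in `F`, then `E` is measurable with respect to the
largest `F`-factor. -/
theorem measurable_largestFactor {F : MPSystem → Prop} (S : MPSystem) {E : S.carrier → ℂ}
    (hE : Measurable E) (hF : F (itinerarySystem S E hE)) : Measurable[largestFactor F S] E := by
  have hfac : IsFFactor F S ((itinerarySystem S E hE).measurableSpace.comap
      (itinerary S.map E)) :=
    ⟨(measurable_itinerary S.map hE).comap_le, _, _, hF, isFactorMap_itinerary S E hE, rfl⟩
  have hle : (itinerarySystem S E hE).measurableSpace.comap (itinerary S.map E) ≤
      largestFactor F S := le_sSup hfac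
  intro s hs
  -- `E` is the coordinate at time 0 of its own itinerary.
  exact hle _ ⟨(fun w : ℤ → ℂ => w 0) ⁻¹' s, measurable_pi_apply (0 : ℤ) hs, rfl⟩

/-! ### Relatively independent powers of a joining -/

section RelIndepPower

variable {F : MPSystem → Prop} (S Y : MPSystem) (ρ : Measure (S.carrier × Y.carrier))
  [IsProbabilityMeasure ρ] [Nonempty Y.carrier]

/-- The joint law of a point of `S` and a sequence of points of `Y`, independent given it. -/
noncomputable def relIndepPower : Measure (S.carrier × (ℕ → Y.carrier)) :=
  S.measure.compProd ρ.condKernel.iidPower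

instance : IsProbabilityMeasure (relIndepPower S Y ρ) := by
  unfold relIndepPower; infer_instance

variable {S Y ρ}

/-- The disintegration of an invariant measure is equivariant almost everywhere, and independent
powers inherit this fibre by fibre. -/
theorem measurePreserving_relIndepPower (hfst : ρ.fst = S.measure)
    (hinv : MeasurePreserving (Prod.map S.map Y.map) ρ ρ) :
    MeasurePreserving (S.map.prodCongr (prodMap fun _ : ℕ => Y)) (relIndepPower S Y ρ)
      (relIndepPower S Y ρ) := by
  refine ⟨MeasurableEquiv.measurable _, ?_⟩
  have h := ProbabilityTheory.Kernel.ae_condKernel_equivariant ρ S.map Y.map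
    (hfst ▸ S.measurePreserving) hinv
  rw [hfst] at h
  exact S.measurePreserving.map_compProd (prodMap fun _ : ℕ => Y).measurable
    ρ.condKernel.iidPower ρ.condKernel.iidPower
    (h.mono fun z hz => ρ.condKernel.iidPower_equivariant Y.map.measurable hz)

/-- This is what places the sequence of points in the class: it is a joining of countably many
copies of `Y`. -/
theorem isJoining_relIndepPower_snd (hfst : ρ.fst = S.measure) (hsnd : ρ.snd = Y.measure)
    (hinv : MeasurePreserving (Prod.map S.map Y.map) ρ ρ) :
    IsJoining (fun _ : ℕ => Y) (relIndepPower S Y ρ).snd := by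
  refine ⟨inferInstance, ⟨MeasurableEquiv.measurable _, ?_⟩, fun i => ?_⟩
  · rw [Measure.snd, Measure.map_map (MeasurableEquiv.measurable _) measurable_snd]
    conv_rhs => rw [← (measurePreserving_relIndepPower hfst hinv).map_eq,
      Measure.map_map measurable_snd (MeasurableEquiv.measurable _)]
    rfl
  · have hi : Measurable fun w : ℕ → Y.carrier => w i := measurable_pi_apply i
    -- Keeping `z` and only the `i`-th point of the sequence gives back `ρ`.
    have h := (MeasurePreserving.id S.measure).map_compProd hi
      ρ.condKernel.iidPower ρ.condKernel (Eventually.of_forall fun z => by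
        rw [ProbabilityTheory.Kernel.iidPower_apply]
        exact (Measure.infinitePi_map_eval (fun _ : ℕ => ρ.condKernel z) i).symm)
    rw [← hfst, ρ.disintegrate, hfst] at h
    rw [← hsnd, Measure.snd, Measure.map_map hi measurable_snd, Measure.snd]
    conv_rhs => rw [← h, Measure.map_map measurable_snd
      (measurable_id.prodMap hi)]
    rfl

/-- In a joining of `S` with a system of the class `F`, the conditional expectation on `S` of a
bounded function of the other coordinate is measurable with respect to the largest
`F`-factor. -/
theorem measurable_largestFactor_integral_condKernel (hF : IsCharacteristic F) (hY : F Y)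
    (hfst : ρ.fst = S.measure) (hsnd : ρ.snd = Y.measure)
    (hinv : MeasurePreserving (Prod.map S.map Y.map) ρ ρ)
    {f : Y.carrier → ℂ} (hf : Measurable f) {C : ℝ} (hC : ∀ y, ‖f y‖ ≤ C) :
    Measurable[largestFactor F S] fun z => ∫ y, f y ∂ρ.condKernel z := by
  have hE : Measurable fun z => ∫ y, f y ∂ρ.condKernel z :=
    (hf.comp measurable_snd).stronglyMeasurable.integral_kernel_prod_right'.measurable
  set E : S.carrier → ℂ := fun z => ∫ y, f y ∂ρ.condKernel z
  let avg : ℕ → (ℕ → Y.carrier) → ℂ := fun n x => (n : ℝ)⁻¹ • ∑ i ∈ Finset.range n, f (x i)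
  have havg : ∀ n, Measurable (avg n) := fun n =>
    (Finset.measurable_fun_sum _ fun i _ => hf.comp (measurable_pi_apply i)).const_smul (n : ℝ)⁻¹
  -- Where the averages diverge, `limUnder` takes an arbitrary value; this happens only on a null
  -- set, and `G` is measurable everywhere.
  let G : (ℕ → Y.carrier) → ℂ := fun x => limUnder atTop fun n => avg n x
  have hG : Measurable G :=
    (StronglyMeasurable.limUnder fun n => (havg n).stronglyMeasurable).measurable
  have hEG : (E ∘ Prod.fst) =ᵐ[relIndepPower S Y ρ] (G ∘ Prod.snd) := by
    refine (Measure.ae_compProd_iff (measurableSet_eq_fun (hE.comp measurable_fst)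
      (hG.comp measurable_snd))).2 (Eventually.of_forall fun z => ?_)
    filter_upwards [ρ.condKernel.ae_iidPower_tendsto hf hC z] with x hx
    exact hx.limUnder_eq.symm
  have hJ := isJoining_relIndepPower_snd hfst hsnd hinv
  let J := joiningSystem (fun _ : ℕ => Y) _ hJ
  have hM := measurePreserving_relIndepPower hfst hinv
  -- Both laws are images of `relIndepPower`, on which the two itineraries agree almost everywhere.
  have hlaw : S.measure.map (itinerary S.map E) = J.measure.map (itinerary J.map G) := by
    have h := Measure.map_congr (mβ := MeasurableSpace.pi) (itinerary_ae_eq _ hM hEG)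
    have h1 : itinerary (S.map.prodCongr (prodMap fun _ : ℕ => Y)) (E ∘ Prod.fst) =
        itinerary S.map E ∘ Prod.fst := funext fun p => itinerary_semiconj (π := Prod.fst) _ _ (fun _ => rfl) E p
    have h2 : itinerary (S.map.prodCongr (prodMap fun _ : ℕ => Y)) (G ∘ Prod.snd) =
        itinerary J.map G ∘ Prod.snd := funext fun p => itinerary_semiconj (π := Prod.snd) _ _ (fun _ => rfl) G p
    rw [h1, h2, ← Measure.map_map (measurable_itinerary _ hE) measurable_fst] at h
    refine Eq.trans ?_ (h.trans
      (Measure.map_map (measurable_itinerary J.map hG) measurable_snd).symm)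
    congr 1
    exact (Measure.fst_compProd S.measure ρ.condKernel.iidPower).symm
  refine measurable_largestFactor S hE (hF.factor J _ (itinerary J.map G)
    (hF.joining ℕ _ _ hJ fun _ => hY) ⟨⟨measurable_itinerary J.map hG, hlaw.symm⟩, ?_⟩)
  exact Eventually.of_forall fun x => itinerary_map J.map G x

end RelIndepPower

/-- Orthogonality to the largest `F`-factor of `S` forces orthogonality, in any joining of `S` with
a system of the class `F`, to the functions of the other coordinate. -/
theorem integral_mul_eq_zero_of_orthogonalToL2 {F : MPSystem → Prop} {S Y : MPSystem}
    {ρ : Measure (S.carrier × Y.carrier)} (hρ : IsProbabilityMeasure ρ) (hF : IsCharacteristic F) (hY : F Y)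
    (hfst : ρ.fst = S.measure) (hsnd : ρ.snd = Y.measure)
    (hinv : MeasurePreserving (Prod.map S.map Y.map) ρ ρ)
    {g : S.carrier → ℂ} (hg : Measurable g) {B : ℝ} (hB : ∀ z, ‖g z‖ ≤ B)
    (horth : OrthogonalToL2 S.measure (largestFactor F S) g)
    {f : Y.carrier → ℂ} (hf : Measurable f) {C : ℝ} (hC : ∀ y, ‖f y‖ ≤ C) :
    ∫ p, g p.1 * f p.2 ∂ρ = 0 := by
  have : Nonempty Y.carrier := Measure.nonempty_of_neZero Y.measure
  have hEF := measurable_largestFactor_integral_condKernel hF hY hfst hsnd hinv hf hC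
  have hE : Measurable fun z => ∫ y, f y ∂ρ.condKernel z :=
    (hf.comp measurable_snd).stronglyMeasurable.integral_kernel_prod_right'.measurable
  have hint : Integrable (fun p : S.carrier × Y.carrier => g p.1 * f p.2)
      (S.measure.compProd ρ.condKernel) := by
    refine Integrable.of_bound ((hg.comp measurable_fst).mul
      (hf.comp measurable_snd)).aestronglyMeasurable (B * C) (Eventually.of_forall fun p => ?_)
    rw [norm_mul]
    exact mul_le_mul (hB _) (hC _) (norm_nonneg _) ((norm_nonneg _).trans (hB p.1))
  rw [← ρ.disintegrate ρ.condKernel, hfst, Measure.integral_compProd hint]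
  have hmem : MemLp (fun z => starRingEnd ℂ (∫ y, f y ∂ρ.condKernel z)) 2 S.measure := by
    refine MemLp.of_bound (Complex.continuous_conj.measurable.comp hE).aestronglyMeasurable C
      (Eventually.of_forall fun z => ?_)
    rw [RCLike.norm_conj]
    simpa using norm_integral_le_of_norm_le_const (μ := ρ.condKernel z) (Eventually.of_forall hC)
  -- The test function is the conjugate of the conditional expectation, because the inner product
  -- conjugates it back.
  have h := horth _ (Complex.continuous_conj.measurable.comp hEF).stronglyMeasurable hmem
  simpa only [Function.comp_apply, Complex.conj_conj, integral_const_mul] using h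

end MPSystem

/-! ### Generic points along subsequences -/

theorem IsGenericAlong.map {X Y : Type} [TopologicalSpace X] [MeasurableSpace X] [BorelSpace X]
    [SecondCountableTopology X] [PseudoMetrizableSpace X]
    [TopologicalSpace Y] [MeasurableSpace Y] [BorelSpace Y] {R : Y ≃ₜ Y} {T : X ≃ₜ X} {y : Y}
    {ν : Measure Y} {N : ℕ → ℕ} (h : IsGenericAlong R y ν N) {π : Y → X} (hπ : Continuous π)
    (hπR : Function.Semiconj π R T) : IsGenericAlong T (π y) (ν.map π) N := by
  intro f
  rw [integral_map hπ.measurable.aemeasurable f.continuous.measurable.aestronglyMeasurable]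
  refine (h (f.comp ⟨π, hπ⟩)).congr fun ℓ => ?_
  congr 1
  exact Finset.sum_congr rfl fun n _ => congrArg f (hπR.iterate_right n y)

/-- Starting the orbit one step later changes each sum by two boundary terms only, which disappear
after division by `N ℓ → ∞`. -/
theorem IsGenericAlong.measurePreserving {Y : Type} [TopologicalSpace Y] [CompactSpace Y]
    [MetrizableSpace Y] [MeasurableSpace Y] [BorelSpace Y] {R : Y ≃ₜ Y} {y : Y} {ν : Measure Y}
    [IsProbabilityMeasure ν] {N : ℕ → ℕ} (hN : StrictMono N) (h : IsGenericAlong R y ν N) :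
    MeasurePreserving R ν ν := by
  refine ⟨R.continuous.measurable, ?_⟩
  have := Measure.isProbabilityMeasure_map (μ := ν) R.continuous.measurable.aemeasurable
  have hmap := h.map R.continuous (T := R) fun _ => rfl
  refine ext_of_forall_integral_eq_of_IsFiniteMeasure fun f => ?_
  let g : C(Y, ℂ) := ⟨fun z => (f z : ℂ), by fun_prop⟩
  have hg : ∫ z, g z ∂(ν.map R) = ∫ z, g z ∂ν := by
    refine tendsto_nhds_unique (hmap g) ?_
    rw [← add_zero (∫ z, g z ∂ν)]
    have hsum : ∀ M : ℕ, ∑ n ∈ Finset.Icc 1 M, g (R^[n] (R y)) =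
        ∑ n ∈ Finset.Icc 1 M, g (R^[n] y) + (g (R^[M] (R y)) - g (R y)) := by
      intro M
      induction M with
      | zero => simp
      | succ M ih =>
        rw [Finset.sum_Icc_succ_top (by omega), Finset.sum_Icc_succ_top (by omega), ih,
          Function.iterate_succ_apply R M y]
        ring
    have hlim : Tendsto (fun ℓ => (1 / (N ℓ : ℂ)) * (g (R^[N ℓ] (R y)) - g (R y))) atTop (𝓝 0) := by
      have h1 : Tendsto (fun ℓ => (1 / (N ℓ : ℂ))) atTop (𝓝 0) :=
        tendsto_one_div_atTop_nhds_zero_nat.comp hN.tendsto_atTop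
      refine h1.zero_mul_isBoundedUnder_le ⟨‖f‖ + ‖f‖, eventually_map.2
        (Eventually.of_forall fun ℓ => (norm_sub_le _ _).trans ?_)⟩
      have hle : ∀ z, ‖g z‖ ≤ ‖f‖ := fun z => by
        change ‖(f z : ℂ)‖ ≤ _
        rw [Complex.norm_real]
        exact f.norm_coe_le_norm z
      exact add_le_add (hle _) (hle _)
    refine ((h g).add hlim).congr fun ℓ => ?_
    rw [hsum, mul_add]
  have hg' : ((∫ z, f z ∂(ν.map R) : ℝ) : ℂ) = ((∫ z, f z ∂ν : ℝ) : ℂ) := by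
    rw [← integral_complex_ofReal, ← integral_complex_ofReal]
    exact hg
  exact_mod_cast hg'

/-- The empirical measure `(1 / (M + 1)) ∑_{1 ≤ n ≤ M + 1} δ_{R^n y}`. -/
noncomputable def empiricalMeasure {Y : Type} [MeasurableSpace Y] (R : Y → Y) (y : Y) (M : ℕ) :
    ProbabilityMeasure Y :=
  ⟨((M + 1 : ℕ) : ENNReal)⁻¹ • ∑ n ∈ Finset.Icc 1 (M + 1), Measure.dirac (R^[n] y), ⟨by
    rw [Measure.smul_apply, Measure.finsetSum_apply]
    simp only [measure_univ, Finset.sum_const, Nat.card_Icc, smul_eq_mul, nsmul_eq_mul, mul_one]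
    exact ENNReal.inv_mul_cancel (by simp) (by simp)⟩⟩

theorem integral_empiricalMeasure {Y : Type} [TopologicalSpace Y] [CompactSpace Y]
    [MetrizableSpace Y] [MeasurableSpace Y] [BorelSpace Y] (R : Y → Y) (y : Y) (M : ℕ)
    (f : C(Y, ℂ)) : ∫ z, f z ∂(empiricalMeasure R y M : Measure Y) =
      (1 / ((M + 1 : ℕ) : ℂ)) * ∑ n ∈ Finset.Icc 1 (M + 1), f (R^[n] y) := by
  change ∫ z, f z ∂(((M + 1 : ℕ) : ENNReal)⁻¹ •
    ∑ n ∈ Finset.Icc 1 (M + 1), Measure.dirac (R^[n] y)) = _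
  rw [integral_smul_measure, integral_finsetSum_measure fun n _ => integrable_dirac (by simp)]
  simp only [integral_dirac]
  rw [ENNReal.toReal_inv, ENNReal.toReal_natCast, Complex.real_smul, Complex.ofReal_inv,
    Complex.ofReal_natCast, one_div]

/-- Along every increasing sequence a point of a compact system has a subsequence along which it
is generic for some measure. -/
theorem exists_isGenericAlong_subseq {Y : Type} [TopologicalSpace Y] [CompactSpace Y]
    [MetrizableSpace Y] [MeasurableSpace Y] [BorelSpace Y] (R : Y ≃ₜ Y) (y : Y) {N : ℕ → ℕ}
    (hN : StrictMono N) : ∃ (ν : Measure Y) (φ : ℕ → ℕ), IsProbabilityMeasure ν ∧ StrictMono φ ∧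
      IsGenericAlong R y ν (N ∘ φ) := by
  -- `N 0` may be 0, so indices start at `ℓ + 1`; the `- 1` offsets the `M + 1` points of
  -- `empiricalMeasure`.
  obtain ⟨ν, -, φ, hφ, hlim⟩ := (isCompact_univ (X := ProbabilityMeasure Y)).isSeqCompact
    (x := fun ℓ => empiricalMeasure R y (N (ℓ + 1) - 1)) fun _ => Set.mem_univ _
  refine ⟨ν, fun ℓ => φ ℓ + 1, inferInstance, fun a b hab => Nat.succ_lt_succ (hφ hab),
    fun f => ?_⟩
  have h := (ProbabilityMeasure.tendsto_iff_forall_integral_rclike_tendsto ℂ).1 hlim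
    (BoundedContinuousFunction.mkOfCompact f)
  refine h.congr fun ℓ => ?_
  have hpos : N (φ ℓ + 1) - 1 + 1 = N (φ ℓ + 1) :=
    Nat.sub_add_cancel (Nat.succ_le_of_lt ((Nat.zero_le _).trans_lt (hN (Nat.lt_succ_self _))))
  change ∫ z, f z ∂(empiricalMeasure R y (N (φ ℓ + 1) - 1) : Measure Y) = _
  rw [integral_empiricalMeasure, hpos]
  rfl

/-! ### The orbit closure of a bounded function -/

theorem norm_coord_le_of_mem_orbitClosure {u : ℕ → ℂ} {L : ℝ} (hL : ∀ n, ‖u n‖ ≤ L) {v : ℤ → ℂ}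
    (hv : v ∈ orbitClosure u) (k : ℤ) : ‖v k‖ ≤ L := by
  have hcl : IsClosed {w : ℤ → ℂ | ‖w k‖ ≤ L} := isClosed_le (by fun_prop) continuous_const
  refine closure_minimal ?_ hcl hv
  rintro _ ⟨j, rfl⟩
  exact hL _

theorem isCompact_orbitClosure {u : ℕ → ℂ} {L : ℝ} (hL : ∀ n, ‖u n‖ ≤ L) :
    IsCompact (orbitClosure u) :=
  (isCompact_univ_pi fun _ : ℤ => isCompact_closedBall (0 : ℂ) L).of_isClosed_subset
    isClosed_closure fun v hv k _ => by
      simpa using norm_coord_le_of_mem_orbitClosure hL hv k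

theorem continuous_coordZero (u : ℕ → ℂ) : Continuous (coordZero u) :=
  (continuous_apply 0).comp continuous_subtype_val

/-- Forward iterates read only coordinates `n ≥ 0`, so the extension of `u` to negative integers
plays no role here. -/
theorem coordZero_iterate_orbitShift (u : ℕ → ℂ) (n : ℕ) :
    coordZero u ((orbitShift u)^[n] (orbitPoint u)) = u n := by
  have h : ∀ (n : ℕ) (z : orbitClosure u) (k : ℤ), ((orbitShift u)^[n] z).1 k = z.1 (k + n) := by
    intro n
    induction n with
    | zero => intro z k; simp
    | succ n ih =>
      intro z k
      rw [Function.iterate_succ_apply, ih]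
      change z.1 (k + n + 1) = _
      rw [Nat.cast_succ, add_assoc]
  change ((orbitShift u)^[n] (orbitPoint u)).1 0 = u n
  rw [h, zero_add]
  rfl

/-! ### Orthogonality to the topological class -/

theorem theoremA (F : MPSystem → Prop) (hF : MPSystem.IsCharacteristic F)
    (u : ℕ → ℂ) (hu : ∃ L : ℝ, ∀ n, ‖u n‖ ≤ L) (hV : VeechCondition F u)
    (X : Type) [MetricSpace X] [CompactSpace X] [MeasurableSpace X] [BorelSpace X]
    (T : X ≃ₜ X) (hT : MemTopClass F T) :
    SarnakProperty u T := by
  obtain ⟨L, hL⟩ := hu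
  intro f x
  have : CompactSpace (orbitClosure u) := isCompact_iff_compactSpace.1 (isCompact_orbitClosure hL)
  by_contra hnot
  obtain ⟨ε, hε, hfreq⟩ : ∃ ε > 0, ∃ᶠ N : ℕ in atTop,
      ε ≤ ‖(1 / (N : ℂ)) * ∑ n ∈ Finset.Icc 1 N, f (T^[n] x) * u n‖ := by
    simp only [Metric.tendsto_nhds, dist_zero_right, not_forall, Filter.not_eventually, not_lt] at hnot
    obtain ⟨ε, hε, h⟩ := hnot
    exact ⟨ε, hε, h⟩
  obtain ⟨N, hN, hNε⟩ := extraction_of_frequently_atTop hfreq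
  let R := (orbitShift u).prodCongr T
  obtain ⟨ρ, φ, hρ, hφ, hgen⟩ := exists_isGenericAlong_subseq R (orbitPoint u, x) hN
  have hNφ : StrictMono (N ∘ φ) := hN.comp hφ
  have hinv := hgen.measurePreserving hNφ
  -- Projecting the generic pair shows that each marginal of `ρ` is visible, as the Veech condition
  -- and `MemTopClass` require.
  have hgen1 := hgen.map continuous_fst (T := orbitShift u) fun _ => rfl
  have hgen2 := hgen.map continuous_snd (T := T) fun _ => rfl
  have hp1 : IsProbabilityMeasure ρ.fst := inferInstance
  have hp2 : IsProbabilityMeasure ρ.snd := inferInstance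
  have hinv1 : MeasurePreserving (orbitShift u) ρ.fst ρ.fst :=
    hgen1.measurePreserving (ν := ρ.fst) hNφ
  have hinv2 : MeasurePreserving T ρ.snd ρ.snd := hgen2.measurePreserving (ν := ρ.snd) hNφ
  have hzero := MPSystem.integral_mul_eq_zero_of_orthogonalToL2
    (S := measureSystem (orbitShift u) ρ.fst hinv1) (Y := measureSystem T ρ.snd hinv2) (ρ := ρ) hρ hF
    (hT ρ.snd hinv2 (Set.mem_iUnion.2 ⟨x, hp2, N ∘ φ, hNφ, hgen2⟩)) rfl rfl hinv
    (continuous_coordZero u).measurable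
    (fun z => norm_coord_le_of_mem_orbitClosure hL z.2 0)
    (hV ρ.fst hinv1 ⟨hp1, N ∘ φ, hNφ, hgen1⟩) f.continuous.measurable f.norm_coe_le_norm
  have hlim := hgen ⟨fun p => coordZero u p.1 * f p.2,
    ((continuous_coordZero u).comp continuous_fst).mul (f.continuous.comp continuous_snd)⟩
  simp only [ContinuousMap.coe_mk] at hlim
  rw [show ∫ p, coordZero u p.1 * f p.2 ∂ρ = 0 from hzero] at hlim
  have hiter : ∀ n : ℕ, R^[n] (orbitPoint u, x) = ((orbitShift u)^[n] (orbitPoint u), T^[n] x) :=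
    fun n => congrFun (Prod.map_iterate (orbitShift u) T n) (orbitPoint u, x)
  simp only [hiter, coordZero_iterate_orbitShift] at hlim
  -- The lower bound `ε` holds along all of `N`, so it survives in the limit along `N ∘ φ`.
  have hle : ε ≤ ‖(0 : ℂ)‖ := ge_of_tendsto hlim.norm (Eventually.of_forall fun ℓ => by
    simpa only [mul_comm (u _), Function.comp_apply] using hNε (φ ℓ))
  exact absurd hε (by simpa using hle)
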